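/- A \emph{memory model} consists of a directed graph $(M,E)$ (whose vertices are called cells), an initial cell $m_0\in M$, and a map $g\colon E\to G$ to a finite set $G$ of marks such that, for each cell $u$, $g$ restricts to a bijection from the set of edges leaving $u$ onto $G$. An \emph{$h$-head automaton with an auxiliary memory of model $M$} has a finite state set $Q$, a finite input alphabet $\Sigma$, two end markers $\triangleleft,\triangleright\notin\Sigma$, a finite memory alphabet $\Delta$, an initial state $q_0\in Q$, a set $Q_a\subseteq Q$ of accepting states, and a transition function $$\delta\colon Q\times(\Sigma\cup\{\triangleleft,\triangleright\})^h\times\Delta\to Q\times\{-1,0,+1\}^h\times(G\cup\{\text{empty command}\}).$$ On an input word $w\in\Sigma^*$ and a memory content $\mu\colon M\to\Delta$ (the guess, which is read-only), it works deterministically. It starts in state $q_0$, with all $h$ heads on the leftmost symbol of the extended word $\triangleleft w\triangleright$, and at the cell $m_0$. In each step it applies $\delta$ to the current state, the symbols under the heads and the value of $\mu$ at the current cell; it then enters the new state, shifts each head by the given amount (a head that would leave the extended word stays in place), and moves to another cell along the edge leaving the current cell that carries the given mark (or stays in its cell, for the empty command). It stops if and only if it reaches a state of $Q_a$. The automaton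 \emph{accepts} $w$ if it stops for at least one memory content $\mu\in\Delta^M$, and it \emph{recognizes} the language $L\subseteq\Sigma^*$ if it accepts exactly the words of $L$. Let $\mathbf R(M)$ be the class of all languages, over finite alphabets, that are recognized by $h$-head automata with an auxiliary memory of model $M$, for some $h\ge 1$. Let $\mathbb Z^2$ also denote the memory model given by the Cayley graph of the group $\mathbb Z^2$ with the generators $(\pm1,0)$ and $(0,\pm1)$: the cells are the elements of $\mathbb Z^2$, the initial cell is $(0,0)$, and for each cell $x$ and each generator $s$ there is an edge from $x$ to $x+s$, marked $s$. \textbf{Theorem.} $\mathbf R(\mathbb Z^2)=\mathrm{RE}$; that is, for every finite alphabet $\Sigma$, a language $L\subseteq\Sigma^*$ is recognized by an automaton with an auxiliary memory of model $\mathbb Z^2$ if and only if $L$ is recursively enumerable. -/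

import Mathlib

namespace AuxMemory

universe u

/-- A memory model: a directed graph of memory cells, an initial cell, and a marking of the edges
by a finite set, such that the edges leaving a cell `c` are in bijection with the marks. -/
structure MemoryModel where
  Cell : Type
  graph : Digraph Cell
  init : Cell
  Mark : Type
  finite_mark : Finite Mark
  mark : {e : Cell × Cell // graph.Adj e.1 e.2} → Mark
  mark_injective : ∀ (c d d' : Cell) (h : graph.Adj c d) (h' : graph.Adj c d'),
    mark ⟨(c, d), h⟩ = mark ⟨(c, d'), h'⟩ → d = d'
  mark_surjective : ∀ (c : Cell) (a : Mark),
    ∃ (d : Cell) (h : graph.Adj c d), mark ⟨(c, d), h⟩ = a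

namespace MemoryModel

/-- The cell reached from `c` along the edge marked `a`. -/
noncomputable def next (M : MemoryModel) (c : M.Cell) (a : M.Mark) : M.Cell :=
  (M.mark_surjective c a).choose

/-- The cell after a command: `none` is the empty command, `some a` follows the edge marked `a`. -/
noncomputable def exec (M : MemoryModel) (c : M.Cell) : Option M.Mark → M.Cell
  | none => c
  | some a => M.next c a

end MemoryModel

/-- The Cayley graph of the additive group `A` with respect to the finite set `S`, as a memory
model: an edge marked `s ∈ S` goes from each `x` to `x + s`, and the initial cell is `0`. -/
def cayleyMemory (A : Type) [AddGroup A] (S : Finset A) : MemoryModel where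
  Cell := A
  graph := { Adj := fun x y => ∃ s ∈ S, y = x + s }
  init := 0
  Mark := {s : A // s ∈ S}
  finite_mark := inferInstance
  mark e := ⟨-e.1.1 + e.1.2, by
    obtain ⟨s, hs, h⟩ := e.2
    rw [h, neg_add_cancel_left]
    exact hs⟩
  mark_injective c d d' _ _ h := by
    have h' : -c + d = -c + d' := congrArg Subtype.val h
    exact add_left_cancel h'
  mark_surjective c a := ⟨c + a.1, ⟨a.1, a.2, rfl⟩, Subtype.ext (by simp)⟩

/-- The memory `ℤ²` with the generators `(±1, 0)` and `(0, ±1)`. -/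
def intSquareMemory : MemoryModel :=
  cayleyMemory (ℤ × ℤ) {(1, 0), (-1, 0), (0, 1), (0, -1)}

/-- Symbols of the extended input word: a letter, or one of the two end markers. -/
inductive TapeSymbol (α : Type u) : Type u
  | leftMarker
  | letter (a : α)
  | rightMarker

/-- The symbol at position `p` of the input word `w` extended by the markers: the left marker is at
position `0`, the letters at `1, …, w.length`, and the right marker at `w.length + 1`. -/
def symbolAt {α : Type u} (w : List α) : ℕ → TapeSymbol α
  | 0 => .leftMarker
  | p + 1 => match w[p]? with
    | some a => .letter a
    | none => .rightMarker

/-- Moving a head at position `p` of an extended word with last position `n + 1` by `-1`, `0`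
or `+1`; a head that is told to leave the extended word stays where it is. -/
def moveHead (n p : ℕ) : SignType → ℕ
  | .neg => p - 1
  | .zero => p
  | .pos => min (p + 1) (n + 1)

/-- A deterministic `h`-head two-way automaton with input alphabet `α` and with a read-only
auxiliary memory of model `M`. -/
structure Automaton (h : ℕ) (α : Type u) (M : MemoryModel) where
  State : Type
  finite_state : Finite State
  /-- the memory alphabet -/
  Sym : Type
  finite_sym : Finite Sym
  /-- the transition function: it maps the state, the symbols under the heads and the symbol in the
  current cell to a new state, a motion for each head and a command for the memory -/
  trans : State → (Fin h → TapeSymbol α) → Sym → State × (Fin h → SignType) × Option M.Mark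
  start : State
  accepting : Set State

namespace Automaton

variable {h : ℕ} {α : Type u} {M : MemoryModel}

/-- A configuration: the state, the positions of the heads, and the current memory cell. -/
structure Config (A : Automaton h α M) where
  state : A.State
  head : Fin h → ℕ
  cell : M.Cell

/-- The initial configuration. -/
def initial (A : Automaton h α M) : A.Config := ⟨A.start, fun _ => 0, M.init⟩

/-- One step on the input `w` with the memory content `μ`. -/
noncomputable def step (A : Automaton h α M) (w : List α) (μ : M.Cell → A.Sym) (c : A.Config) :
    A.Config :=
  let r := A.trans c.state (fun i => symbolAt w (c.head i)) (μ c.cell)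
  ⟨r.1, fun i => moveHead w.length (c.head i) (r.2.1 i), M.exec c.cell r.2.2⟩

/-- `A` accepts `w` if for some memory content it reaches an accepting state (and so stops). -/
def Accepts (A : Automaton h α M) (w : List α) : Prop :=
  ∃ (μ : M.Cell → A.Sym) (t : ℕ), ((A.step w μ)^[t] A.initial).state ∈ A.accepting

/-- `A` recognizes `L` if it accepts exactly the words of `L`. -/
def Recognizes (A : Automaton h α M) (L : Language α) : Prop :=
  ∀ w : List α, A.Accepts w ↔ w ∈ L

end Automaton

/-- The languages over `α` recognized by `h`-head automata with an auxiliary memory of model `M`. -/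
def RHeads (M : MemoryModel) (h : ℕ) (α : Type u) : Set (Language α) :=
  {L | ∃ A : Automaton h α M, A.Recognizes L}

/-- The languages over `α` recognized by automata with any positive number of heads and an auxiliary
memory of model `M`. -/
def R (M : MemoryModel) (α : Type u) : Set (Language α) :=
  {L | ∃ h : ℕ, 1 ≤ h ∧ L ∈ RHeads M h α}

/-- The recursively enumerable languages over `α`. For a finite `α` this does not depend on the
choice of the encoding, since every function on a finite type is primitive recursive. -/
def RE (α : Type u) [Primcodable α] : Set (Language α) :=
  {L | REPred fun w : List α => w ∈ L}

end AuxMemory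

/-!
A language is recognized with the memory `ℤ²` exactly if it is recursively enumerable, because a
guessed labelling of the plane can be a space-time diagram, and a finite automaton that walks in the
plane can check such a diagram.

Let a recursively enumerable language be given. Mathlib translates partial recursive functions into
programs for finitely many stacks (`Turing.PartrecToTM2`); such a program is run by a
`StackMachine`, which has a finite control, applies one elementary operation to each stack in a
step, and first loads the input word from its two-way head onto a stack
(`exists_stackMachine_accepts_iff`). In its diagram, row `t` contains the stacks at time `t`, with
the tops in column `0`, and each row carries marks at its two ends. Since pushing and popping shift
a stack by one column, the new row is determined by the old one through a condition on neighbouring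
columns. The automaton `StackMachine.checker` keeps the state of the machine in its own state and
sweeps over the rows. It goes up and down between a row and the next one to compare the entries, and
returns along the new row to the left mark. Its input head moves as the head of the machine does, so
one head is enough. If the check fails, it never stops; if a row has no right mark, it runs on for
ever. Hence it can only stop if the machine halts (`StackMachine.CheckInvariant`), and it does stop
on the diagram of a halting computation, with rows as long as the computation
(`StackMachine.checker_accepts_iff`).

Conversely, an accepting run visits only finitely many cells, so that the guess can be replaced by a
finite list of symbols. The run on such a list is primitive recursive (`Automaton.primrec_stepCode`)
and an unbounded search over the lists and the numbers of steps semi-decides acceptance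
(`Automaton.rePred_accepts`).
-/

namespace AuxMemory

universe u

/-! ### Stack machines -/

/-- An elementary operation on a stack, which is a list with its top first. -/
inductive StackOp (Γ : Type) : Type
  | keep
  | push (a : Γ)
  | pop

/-- The stack after an operation; popping an empty stack has no effect. -/
def StackOp.apply {Γ : Type} : StackOp Γ → List Γ → List Γ
  | keep, l => l
  | push a, l => a :: l
  | pop, l => l.tail

/-- A deterministic machine with a single two-way input head and a finite family of stacks. In each
step the new state may depend on the state, the scanned symbol and the tops of all stacks, whereas
the operation on each stack depends on the state alone. The set of states may be infinite. -/
structure StackMachine (α : Type u) where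
  State : Type
  Stack : Type
  finite_stack : Finite Stack
  Letter : Type
  finite_letter : Finite Letter
  start : State
  halted : Set State
  next : State → TapeSymbol α → (Stack → Option Letter) → State
  move : State → TapeSymbol α → SignType
  op : State → Stack → StackOp Letter

namespace StackMachine

variable {α : Type u}

/-- A configuration: the state, the position of the head, and the stacks. -/
@[ext]
structure Config (T : StackMachine α) where
  state : T.State
  head : ℕ
  stack : T.Stack → List T.Letter

variable (T : StackMachine α)

/-- The initial configuration: the head is on the left marker and all stacks are empty. -/
def initial : T.Config := ⟨T.start, 0, fun _ => []⟩

/-- One step on the input `w`. It is defined for halted configurations, too. -/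
def step (w : List α) (c : T.Config) : T.Config :=
  ⟨T.next c.state (symbolAt w c.head) (fun k => (c.stack k).head?),
    moveHead w.length c.head (T.move c.state (symbolAt w c.head)),
    fun k => (T.op c.state k).apply (c.stack k)⟩

/-- `T` accepts `w` if it reaches a halted state. -/
def Accepts (w : List α) : Prop :=
  ∃ n : ℕ, ((T.step w)^[n] T.initial).state ∈ T.halted

theorem length_stack_le (w : List α) (n : ℕ) (k : T.Stack) :
    (((T.step w)^[n] T.initial).stack k).length ≤ n := by
  induction n with
  | zero => simp [initial]
  | succ n ih =>
    rw [Function.iterate_succ_apply']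
    generalize (T.step w)^[n] T.initial = c at ih
    simp only [step]
    cases T.op c.state k <;> simp [StackOp.apply] <;> omega

end StackMachine

/-! ### Rows of the memory as stack contents -/

/-- The memory alphabet for the space-time diagrams of a machine with stacks indexed by `K`: marks
for the left and the right end of a row, and one symbol (or none) for each stack. -/
structure RowSymbol (K Γ : Type) : Type where
  left : Bool
  right : Bool
  track : K → Option Γ

instance {K Γ : Type} [Finite K] [Finite Γ] : Finite (RowSymbol K Γ) :=
  Finite.of_injective (fun s => (s.left, s.right, s.track)) fun s s' h => by
    cases s; cases s'; simpa using h

/-- The row `r` holds the stacks `S` in the columns `0, …, W`: column `x` contains the letters at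
depth `x`, and the only end marks are those in the columns `0` and `W`. The stacks must fit. -/
structure RowHolds {K Γ : Type} (r : ℕ → RowSymbol K Γ) (S : K → List Γ) (W : ℕ) : Prop where
  left : ∀ x ≤ W, (r x).left = decide (x = 0)
  right : ∀ x ≤ W, (r x).right = decide (x = W)
  track : ∀ x ≤ W, ∀ k, (r x).track k = (S k)[x]?
  length_le : ∀ k, (S k).length ≤ W

/-- The local condition, in one column, for the new track `b` to arise from the old track `a` by
the stack operation. The argument before `a` is the pair of the old and the new entry in the
preceding column, or `none` in column `0`. In the case of `pop` the condition concerns the new entry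
of the preceding column, since the entries are shifted to the left. -/
def StackOp.Check {Γ : Type} : StackOp Γ → Option (Option Γ × Option Γ) → Option Γ → Option Γ → Prop
  | keep, _, a, b => b = a
  | push c, p, _, b => b = p.elim (some c) Prod.fst
  | pop, p, a, _ => ∀ e ∈ p, e.2 = a

/-- The local condition in one column of two successive rows, for a machine in the state `q`. The
second argument is `none` in column `0`; in the other columns it consists of the state to come and
of the old and the new tracks in the preceding column. -/
def ColumnCheck {α : Type u} (T : StackMachine α) (q : T.State)
    (p : Option (T.State × (T.Stack → Option T.Letter) × (T.Stack → Option T.Letter)))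
    (a b : RowSymbol T.Stack T.Letter) : Prop :=
  b.left = p.isNone ∧ a.right = b.right ∧ ∀ k, (b.right = true → b.track k = none) ∧
    (T.op q k).Check (p.map fun e => (e.2.1 k, e.2.2 k)) (a.track k) (b.track k)

/-- What is carried into column `x` when the rows `r` and `r'` are compared, if `q'` is the state
to come. -/
def carry {Q K Γ : Type} (q' : Q) (r r' : ℕ → RowSymbol K Γ) :
    ℕ → Option (Q × (K → Option Γ) × (K → Option Γ))
  | 0 => none
  | x + 1 => some (q', (r x).track, (r' x).track)

theorem carry_isNone {Q K Γ : Type} (q' : Q) (r r' : ℕ → RowSymbol K Γ) (x : ℕ) :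
    (carry q' r r' x).isNone = decide (x = 0) := by
  cases x <;> simp [carry]

/-- If all columns up to the first right mark of the new row pass the check, then the new row holds
the new stacks. -/
theorem RowHolds.of_columnCheck {α : Type u} {T : StackMachine α} {q q' : T.State}
    {r r' : ℕ → RowSymbol T.Stack T.Letter} {S : T.Stack → List T.Letter} {W x : ℕ}
    (hr : RowHolds r S W) (hc : ∀ y ≤ x, ColumnCheck T q (carry q' r r' y) (r y) (r' y))
    (hlt : ∀ y < x, (r' y).right = false) (hx : (r' x).right = true) :
    RowHolds r' (fun k => (T.op q k).apply (S k)) x := by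
  -- The right marks agree in the two rows, so that both rows end in the same column.
  have hWx : W = x := by
    have h1 : ∀ y ≤ x, (r y).right = (r' y).right := fun y hy => (hc y hy).2.1
    rcases lt_trichotomy W x with h | h | h
    · have := hr.right W le_rfl
      rw [h1 W h.le, hlt W h] at this
      simp at this
    · exact h
    · have := hr.right x h.le
      rw [h1 x le_rfl, hx] at this
      simp at this
      omega
  subst hWx
  have key : ∀ k, (∀ y ≤ W, (r' y).track k = ((T.op q k).apply (S k))[y]?) := by
    intro k
    have hlen := hr.length_le k
    have hend : (r' W).track k = none := ((hc W le_rfl).2.2 k).1 hx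
    have hk : ∀ y ≤ W, (T.op q k).Check ((carry q' r r' y).map fun e => (e.2.1 k, e.2.2 k))
        ((r y).track k) ((r' y).track k) := fun y hy => ((hc y hy).2.2 k).2
    generalize T.op q k = o at hk
    cases o with
    | keep =>
      intro y hy
      exact (hk y hy).trans (hr.track y hy k)
    | push c =>
      intro y hy
      have := hk y hy
      cases y with
      | zero => simpa [StackOp.Check, StackOp.apply, carry] using this
      | succ y =>
        simpa [StackOp.Check, StackOp.apply, carry, hr.track y (by omega) k] using this
    | pop =>
      intro y hy
      rcases hy.eq_or_lt with rfl | hy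
      · rw [hend]
        simp only [StackOp.apply]
        rw [List.getElem?_eq_none]
        simp
        omega
      · have := hk (y + 1) hy
        simpa [StackOp.Check, StackOp.apply, carry, hr.track (y + 1) hy k] using this
  refine ⟨fun y hy => ?_, fun y hy => ?_, fun y hy k => key k y hy, fun k => ?_⟩
  · rw [(hc y hy).1, carry_isNone]
  · rcases hy.eq_or_lt with rfl | hy
    · simpa using hx
    · rw [hlt y hy]
      simp
      omega
  · have := key k W le_rfl
    rw [((hc W le_rfl).2.2 k).1 hx] at this
    exact List.getElem?_eq_none_iff.1 this.symm

theorem RowHolds.columnCheck {α : Type u} {T : StackMachine α} {q : T.State} (q' : T.State)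
    {r r' : ℕ → RowSymbol T.Stack T.Letter} {S : T.Stack → List T.Letter} {W : ℕ}
    (hr : RowHolds r S W) (hr' : RowHolds r' (fun k => (T.op q k).apply (S k)) W)
    {x : ℕ} (hx : x ≤ W) : ColumnCheck T q (carry q' r r' x) (r x) (r' x) := by
  refine ⟨?_, ?_, fun k => ⟨fun h => ?_, ?_⟩⟩
  · rw [carry_isNone, hr'.left x hx]
  · rw [hr.right x hx, hr'.right x hx]
  · rw [hr'.right x hx] at h
    simp at h
    subst h
    rw [hr'.track x le_rfl]
    exact List.getElem?_eq_none (hr'.length_le k)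
  · have h := hr'.track x hx k
    have ha := hr.track x hx k
    cases ho : T.op q k with
    | keep => simpa [StackOp.Check, ho, StackOp.apply, ha] using h
    | push c =>
      cases x with
      | zero => simpa [StackOp.Check, ho, StackOp.apply, carry] using h
      | succ x =>
        simpa [StackOp.Check, ho, StackOp.apply, carry, hr.track x (by omega) k] using h
    | pop =>
      cases x with
      | zero => simp [StackOp.Check, carry]
      | succ x =>
        have h := hr'.track x (by omega) k
        simpa [StackOp.Check, ho, StackOp.apply, carry, ha] using h

/-! ### Walking in the plane -/

theorem cayleyMemory_exec_some {A : Type} [AddGroup A] {S : Finset A} (c : A)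
    (s : {s : A // s ∈ S}) :
    @Eq A ((cayleyMemory A S).exec c (some s)) (c + s.1) := by
  obtain ⟨h, hm⟩ := ((cayleyMemory A S).mark_surjective c s).choose_spec
  exact (neg_add_eq_iff_eq_add (G := A)).1 (congrArg Subtype.val hm)

/-- The four directions in the plane, as marks of the memory `ℤ²`. -/
inductive Direction : Type
  | right
  | left
  | up
  | down

/-- The generator of `ℤ²` for a direction. -/
def Direction.mark : Direction → intSquareMemory.Mark
  | right => ⟨(1, 0), by simp⟩
  | left => ⟨(-1, 0), by simp⟩
  | up => ⟨(0, 1), by simp⟩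
  | down => ⟨(0, -1), by simp⟩

/-- The cell in column `x` of row `t`. -/
def cellAt (x t : ℕ) : intSquareMemory.Cell := ((x : ℤ), (t : ℤ))

theorem exec_right (x t : ℕ) :
    intSquareMemory.exec (cellAt x t) (some Direction.right.mark) = cellAt (x + 1) t :=
  (cayleyMemory_exec_some (A := ℤ × ℤ) _ _).trans (Prod.ext (by simp [cellAt, Direction.mark])
    (by simp [cellAt, Direction.mark]))

theorem exec_left (x t : ℕ) :
    intSquareMemory.exec (cellAt (x + 1) t) (some Direction.left.mark) = cellAt x t :=
  (cayleyMemory_exec_some (A := ℤ × ℤ) _ _).trans (Prod.ext (by simp [cellAt, Direction.mark])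
    (by simp [cellAt, Direction.mark]))

theorem exec_up (x t : ℕ) :
    intSquareMemory.exec (cellAt x t) (some Direction.up.mark) = cellAt x (t + 1) :=
  (cayleyMemory_exec_some (A := ℤ × ℤ) _ _).trans (Prod.ext (by simp [cellAt, Direction.mark])
    (by simp [cellAt, Direction.mark]))

theorem exec_down (x t : ℕ) :
    intSquareMemory.exec (cellAt x (t + 1)) (some Direction.down.mark) = cellAt x t :=
  (cayleyMemory_exec_some (A := ℤ × ℤ) _ _).trans (Prod.ext (by simp [cellAt, Direction.mark])
    (by simp [cellAt, Direction.mark]))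

theorem moveHead_zero (n p : ℕ) : moveHead n p 0 = p := rfl

/-! ### The automaton that checks a space-time diagram -/

/-- The states of the automaton that checks a space-time diagram, for a machine with states `Q`,
stacks indexed by `K` and stack alphabet `Γ`.
* `init b`: checks that row `0` is blank; `b` tells whether the column is the first one;
* `scan q p`: is in a row that holds the stacks of a configuration with state `q`, going right;
  `p` is what is carried from the preceding column;
* `up q p a`: has read `a` in the lower row and is about to read the entry above it;
* `down q p`: goes back to the lower row;
* `back q`: returns to the beginning of a row with state `q`;
* `dead`: has found an error. -/
inductive CheckState (Q K Γ : Type) : Type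
  | init (b : Bool)
  | scan (q : Q) (p : Option (Q × (K → Option Γ) × (K → Option Γ)))
  | up (q : Q) (p : Option (Q × (K → Option Γ) × (K → Option Γ))) (a : RowSymbol K Γ)
  | down (q : Q) (p : Q × (K → Option Γ) × (K → Option Γ))
  | back (q : Q)
  | dead

instance {Q K Γ : Type} [Finite Q] [Finite K] [Finite Γ] : Finite (CheckState Q K Γ) := by
  let C := Q × (K → Option Γ) × (K → Option Γ)
  let f : Bool ⊕ (Q × Option C) ⊕ (Q × Option C × RowSymbol K Γ) ⊕ (Q × C) ⊕ Q ⊕ Unit →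
      CheckState Q K Γ := fun s => match s with
    | .inl b => .init b
    | .inr (.inl (q, p)) => .scan q p
    | .inr (.inr (.inl (q, p, a))) => .up q p a
    | .inr (.inr (.inr (.inl (q, p)))) => .down q p
    | .inr (.inr (.inr (.inr (.inl q)))) => .back q
    | .inr (.inr (.inr (.inr (.inr ())))) => .dead
  refine Finite.of_surjective f fun s => ?_
  cases s with
  | init b => exact ⟨.inl b, rfl⟩
  | scan q p => exact ⟨.inr (.inl (q, p)), rfl⟩
  | up q p a => exact ⟨.inr (.inr (.inl (q, p, a))), rfl⟩
  | down q p => exact ⟨.inr (.inr (.inr (.inl (q, p)))), rfl⟩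
  | back q => exact ⟨.inr (.inr (.inr (.inr (.inl q)))), rfl⟩
  | dead => exact ⟨.inr (.inr (.inr (.inr (.inr ())))), rfl⟩

namespace StackMachine

variable {α : Type u} (T : StackMachine α)

/-- The state to come, if it is not yet carried along: it depends on the stack tops, which are found
in column `0`. -/
def nextCarried (q : T.State) (s : TapeSymbol α) (a : RowSymbol T.Stack T.Letter) :
    Option (T.State × (T.Stack → Option T.Letter) × (T.Stack → Option T.Letter)) → T.State
  | none => T.next q s a.track
  | some e => e.1

open Classical in
/-- The transitions of the checking automaton. The input head moves when the right end of the new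
row has been checked, exactly as the head of the machine does in the step. -/
noncomputable def checkTrans : CheckState T.State T.Stack T.Letter → (Fin 1 → TapeSymbol α) →
    RowSymbol T.Stack T.Letter →
    CheckState T.State T.Stack T.Letter × (Fin 1 → SignType) × Option intSquareMemory.Mark
  | .init b, _, a =>
    if a.left = b ∧ ∀ k, a.track k = none then
      if a.right then (.back T.start, 0, none) else (.init false, 0, some Direction.right.mark)
    else (.dead, 0, none)
  | .scan q p, _, a => (.up q p a, 0, some Direction.up.mark)
  | .up q p a, s, b =>
    if ColumnCheck T q p a b then
      if b.right then (.back (T.nextCarried q (s 0) a p), fun _ => T.move q (s 0), none)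
      else (.down q (T.nextCarried q (s 0) a p, a.track, b.track), 0, some Direction.down.mark)
    else (.dead, 0, none)
  | .down q e, _, _ => (.scan q (some e), 0, some Direction.right.mark)
  | .back q, _, b =>
    if b.left then (.scan q none, 0, none) else (.back q, 0, some Direction.left.mark)
  | .dead, _, _ => (.dead, 0, none)

/-- The automaton that accepts if the memory content is the space-time diagram of a halting
computation of `T`, with the configuration at time `t` in row `t`. -/
noncomputable def checker [Finite T.State] : Automaton 1 α intSquareMemory where
  State := CheckState T.State T.Stack T.Letter
  finite_state := by
    have := T.finite_stack
    have := T.finite_letter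
    infer_instance
  Sym := RowSymbol T.Stack T.Letter
  finite_sym := by
    have := T.finite_stack
    have := T.finite_letter
    infer_instance
  trans := T.checkTrans
  start := .init true
  accepting := {s | ∃ q ∈ T.halted, s = .back q}

/-- The state carried along is the state of the next configuration. -/
theorem nextCarried_carry (w : List α) (c : T.Config) {r : ℕ → RowSymbol T.Stack T.Letter} {W : ℕ}
    (hS : RowHolds r c.stack W) (r' : ℕ → RowSymbol T.Stack T.Letter) (x : ℕ) :
    T.nextCarried c.state (symbolAt w c.head) (r x) (carry (T.step w c).state r r' x) =
      (T.step w c).state := by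
  cases x with
  | zero =>
    have : (r 0).track = fun k => (c.stack k).head? := funext fun k => by
      rw [hS.track 0 (Nat.zero_le _) k, List.head?_eq_getElem?]
    simp [carry, nextCarried, step, this]
  | succ x => rfl

/-- Row `t` of a memory content, to the right of the initial column. -/
def row {T : StackMachine α} (μ : intSquareMemory.Cell → RowSymbol T.Stack T.Letter) (t x : ℕ) :
    RowSymbol T.Stack T.Letter := μ (cellAt x t)

/-- The space-time diagram of the computation of `T` on `w`, with rows of length `W + 1`. -/
def diagram (w : List α) (W : ℕ) (z : intSquareMemory.Cell) : RowSymbol T.Stack T.Letter where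
  left := decide (z.1 = 0)
  right := decide (z.1 = W)
  track k := (((T.step w)^[z.2.toNat] T.initial).stack k)[z.1.toNat]?

theorem rowHolds_diagram (w : List α) {W t : ℕ} (h : t ≤ W) :
    RowHolds (row (T.diagram w W) t) ((T.step w)^[t] T.initial).stack W where
  left x _ := by simp [row, diagram, cellAt]
  right x _ := by simp [row, diagram, cellAt]
  track x _ k := by simp [row, diagram, cellAt]
  length_le k := (T.length_stack_le w t k).trans h

variable [Finite T.State] (w : List α) (μ : intSquareMemory.Cell → RowSymbol T.Stack T.Letter)

/-- A configuration of the checking automaton. -/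
def checkConfig (s : CheckState T.State T.Stack T.Letter) (p x t : ℕ) : T.checker.Config :=
  ⟨s, fun _ => p, cellAt x t⟩

theorem checker_step_init (b : Bool) (p x t : ℕ) (hb : (row μ t x).left = b)
    (ht : ∀ k, (row μ t x).track k = none) :
    T.checker.step w μ (T.checkConfig (.init b) p x t) =
      if (row μ t x).right then T.checkConfig (.back T.start) p x t
      else T.checkConfig (.init false) p (x + 1) t := by
  have hc : T.checkTrans (.init b) (fun _ => symbolAt w p) (row μ t x) =
      if (row μ t x).right then (.back T.start, 0, none)
      else (.init false, 0, some Direction.right.mark) := by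
    rw [checkTrans, if_pos ⟨hb, ht⟩]
  change Automaton.Config.mk _ _ _ = _
  change T.checker.trans (.init b) (fun _ => symbolAt w p) (μ (cellAt x t)) = _ at hc
  simp only [checkConfig]
  rw [hc]
  cases (row μ t x).right
  · simp [moveHead_zero, exec_right]
  · simp [moveHead_zero, MemoryModel.exec]

theorem checker_step_scan (q : T.State) (e) (p x t : ℕ) :
    T.checker.step w μ (T.checkConfig (.scan q e) p x t) =
      T.checkConfig (.up q e (row μ t x)) p x (t + 1) := by
  change Automaton.Config.mk _ _ _ = Automaton.Config.mk _ _ _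
  congr 1
  exact exec_up x t

theorem checker_step_up (q : T.State) (e) (a) (p x t : ℕ)
    (h : ColumnCheck T q e a (row μ (t + 1) x)) :
    T.checker.step w μ (T.checkConfig (.up q e a) p x (t + 1)) =
      if (row μ (t + 1) x).right then
        T.checkConfig (.back (T.nextCarried q (symbolAt w p) a e))
          (moveHead w.length p (T.move q (symbolAt w p))) x (t + 1)
      else T.checkConfig (.down q (T.nextCarried q (symbolAt w p) a e, a.track,
        (row μ (t + 1) x).track)) p x t := by
  have hc : T.checkTrans (.up q e a) (fun _ => symbolAt w p) (row μ (t + 1) x) =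
      if (row μ (t + 1) x).right then
        (.back (T.nextCarried q (symbolAt w p) a e), fun _ => T.move q (symbolAt w p), none)
      else (.down q (T.nextCarried q (symbolAt w p) a e, a.track, (row μ (t + 1) x).track),
        (0 : Fin 1 → SignType), some Direction.down.mark) := by
    rw [checkTrans, if_pos h]
  change Automaton.Config.mk _ _ _ = _
  change T.checker.trans (.up q e a) (fun _ => symbolAt w p) (μ (cellAt x (t + 1))) = _ at hc
  simp only [checkConfig]
  rw [hc]
  cases (row μ (t + 1) x).right
  · simp [moveHead_zero, exec_down]
  · simp [MemoryModel.exec]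

theorem checker_step_down (q : T.State) (e) (p x t : ℕ) :
    T.checker.step w μ (T.checkConfig (.down q e) p x t) =
      T.checkConfig (.scan q (some e)) p (x + 1) t := by
  change Automaton.Config.mk _ _ _ = Automaton.Config.mk _ _ _
  congr 1
  exact exec_right x t

theorem checker_step_back_zero (q : T.State) (p x t : ℕ) (h : (row μ t x).left = true) :
    T.checker.step w μ (T.checkConfig (.back q) p x t) = T.checkConfig (.scan q none) p x t := by
  have hc : T.checkTrans (.back q) (fun _ => symbolAt w p) (row μ t x) =
      (.scan q none, 0, none) := by
    rw [checkTrans, if_pos h]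
  change Automaton.Config.mk _ _ _ = _
  change T.checker.trans (.back q) (fun _ => symbolAt w p) (μ (cellAt x t)) = _ at hc
  simp only [checkConfig]
  rw [hc]
  simp [moveHead_zero, MemoryModel.exec]

theorem checker_step_back_succ (q : T.State) (p x t : ℕ) (h : (row μ t (x + 1)).left = false) :
    T.checker.step w μ (T.checkConfig (.back q) p (x + 1) t) = T.checkConfig (.back q) p x t := by
  have hc : T.checkTrans (.back q) (fun _ => symbolAt w p) (row μ t (x + 1)) =
      (.back q, 0, some Direction.left.mark) := by
    rw [checkTrans, if_neg (by simp [h])]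
  change Automaton.Config.mk _ _ _ = _
  change T.checker.trans (.back q) (fun _ => symbolAt w p) (μ (cellAt (x + 1) t)) = _ at hc
  simp only [checkConfig]
  rw [hc]
  simp [moveHead_zero, exec_left]

/-- The configurations that the checking automaton can be in: up to the current position the rows
agree with the computation of the machine, or else an error has been found. -/
inductive CheckInvariant : T.checker.Config → Prop
  | init (x : ℕ) (hl : ∀ y < x, (row μ 0 y).left = decide (y = 0))
    (hr : ∀ y < x, (row μ 0 y).right = false) (ht : ∀ y < x, ∀ k, (row μ 0 y).track k = none) :
    CheckInvariant (T.checkConfig (.init (decide (x = 0))) 0 x 0)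
  | scan (n W x t : ℕ) (c : T.Config) (hn : (T.step w)^[n] T.initial = c)
    (hS : RowHolds (row μ t) c.stack W)
    (hc : ∀ y < x, ColumnCheck T c.state (carry (T.step w c).state (row μ t) (row μ (t + 1)) y)
      (row μ t y) (row μ (t + 1) y))
    (hr : ∀ y < x, (row μ (t + 1) y).right = false) :
    CheckInvariant (T.checkConfig (.scan c.state
      (carry (T.step w c).state (row μ t) (row μ (t + 1)) x)) c.head x t)
  | up (n W x t : ℕ) (c : T.Config) (hn : (T.step w)^[n] T.initial = c)
    (hS : RowHolds (row μ t) c.stack W)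
    (hc : ∀ y < x, ColumnCheck T c.state (carry (T.step w c).state (row μ t) (row μ (t + 1)) y)
      (row μ t y) (row μ (t + 1) y))
    (hr : ∀ y < x, (row μ (t + 1) y).right = false) :
    CheckInvariant (T.checkConfig (.up c.state
      (carry (T.step w c).state (row μ t) (row μ (t + 1)) x) (row μ t x)) c.head x (t + 1))
  | down (n W x t : ℕ) (c : T.Config) (hn : (T.step w)^[n] T.initial = c)
    (hS : RowHolds (row μ t) c.stack W)
    (hc : ∀ y < x + 1, ColumnCheck T c.state (carry (T.step w c).state (row μ t) (row μ (t + 1)) y)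
      (row μ t y) (row μ (t + 1) y))
    (hr : ∀ y < x + 1, (row μ (t + 1) y).right = false) :
    CheckInvariant (T.checkConfig (.down c.state
      ((T.step w c).state, (row μ t x).track, (row μ (t + 1) x).track)) c.head x t)
  | back (n W x t : ℕ) (c : T.Config) (hn : (T.step w)^[n] T.initial = c)
    (hS : RowHolds (row μ t) c.stack W) (hx : x ≤ W) :
    CheckInvariant (T.checkConfig (.back c.state) c.head x t)
  | dead (c : T.checker.Config) (h : c.state = .dead) : CheckInvariant c

theorem CheckInvariant.step {c : T.checker.Config} (h : T.CheckInvariant w μ c) :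
    T.CheckInvariant w μ (T.checker.step w μ c) := by
  cases h with
  | init x hl hr ht =>
    by_cases h : (row μ 0 x).left = decide (x = 0) ∧ ∀ k, (row μ 0 x).track k = none
    · rw [T.checker_step_init w μ _ _ _ _ h.1 h.2]
      have hl' : ∀ y ≤ x, (row μ 0 y).left = decide (y = 0) := fun y hy =>
        hy.eq_or_lt.elim (fun e => e ▸ h.1) (hl y)
      have ht' : ∀ y ≤ x, ∀ k, (row μ 0 y).track k = none := fun y hy =>
        hy.eq_or_lt.elim (fun e => e ▸ h.2) (ht y)
      by_cases hx : (row μ 0 x).right = true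
      · rw [if_pos hx]
        refine .back 0 x x 0 T.initial rfl
          ⟨hl', fun y hy => ?_, fun y hy k => ?_, fun k => ?_⟩ le_rfl
        · rcases hy.eq_or_lt with rfl | hy
          · simpa using hx
          · rw [hr y hy]
            simp
            omega
        · rw [ht' y hy]
          simp [initial]
        · simp [initial]
      · rw [if_neg hx]
        have hx' : (row μ 0 x).right = false := by simpa using hx
        exact .init (x + 1) (fun y hy => hl' y (by omega))
          (fun y hy => (Nat.lt_succ_iff.1 hy).eq_or_lt.elim (fun e => e ▸ hx') (hr y))
          (fun y hy => ht' y (by omega))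
    · refine .dead _ ?_
      change (T.checkTrans (.init (decide (x = 0))) _ (row μ 0 x)).1 = _
      rw [checkTrans, if_neg h]
  | scan n W x t c hn hS hc hr =>
    rw [checker_step_scan]
    exact .up n W x t c hn hS hc hr
  | up n W x t c hn hS hc hr =>
    by_cases h : ColumnCheck T c.state (carry (T.step w c).state (row μ t) (row μ (t + 1)) x)
      (row μ t x) (row μ (t + 1) x)
    · rw [T.checker_step_up w μ _ _ _ _ _ _ h, T.nextCarried_carry w c hS]
      have hc' : ∀ y ≤ x, ColumnCheck T c.state
          (carry (T.step w c).state (row μ t) (row μ (t + 1)) y) (row μ t y) (row μ (t + 1) y) :=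
        fun y hy => hy.eq_or_lt.elim (fun e => e ▸ h) (hc y)
      by_cases hx : (row μ (t + 1) x).right = true
      · rw [if_pos hx]
        refine .back (n + 1) x x (t + 1) (T.step w c) ?_ (hS.of_columnCheck hc' hr hx) le_rfl
        rw [Function.iterate_succ_apply', hn]
      · rw [if_neg hx]
        have hx' : (row μ (t + 1) x).right = false := by simpa using hx
        exact .down n W x t c hn hS (fun y hy => hc' y (by omega))
          (fun y hy => (Nat.lt_succ_iff.1 hy).eq_or_lt.elim (fun e => e ▸ hx') (hr y))
    · refine .dead _ ?_
      change (T.checkTrans (.up c.state _ (row μ t x)) _ (row μ (t + 1) x)).1 = _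
      rw [checkTrans, if_neg h]
  | down n W x t c hn hS hc hr =>
    rw [checker_step_down]
    exact .scan n W (x + 1) t c hn hS hc hr
  | back n W x t c hn hS hx =>
    cases x with
    | zero =>
      rw [checker_step_back_zero _ _ _ _ _ _ _ (by simp [hS.left 0 hx])]
      exact .scan n W 0 t c hn hS (by simp) (by simp)
    | succ x =>
      rw [checker_step_back_succ _ _ _ _ _ _ _ (by simp [hS.left _ hx])]
      exact .back n W x t c hn hS (by omega)
  | dead c h =>
    refine .dead _ ?_
    change (T.checkTrans c.state _ _).1 = _
    rw [h]
    rfl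

/-- Whatever the memory content is, the checking automaton stops only in a configuration that
records a halted configuration of the machine. -/
theorem accepts_of_checker_accepts {w : List α} (h : T.checker.Accepts w) : T.Accepts w := by
  obtain ⟨μ, n, hn⟩ := h
  have hinv : T.CheckInvariant w μ ((T.checker.step w μ)^[n] T.checker.initial) := by
    clear hn
    induction n with
    | zero => exact .init 0 (by simp) (by simp) (by simp)
    | succ n ih =>
      rw [Function.iterate_succ_apply']
      exact ih.step
  generalize (T.checker.step w μ)^[n] T.checker.initial = c at hn hinv
  obtain ⟨q, hq, hs⟩ := hn
  cases hinv with
  | back n W x t c hc hS hx =>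
    cases hs
    exact ⟨n, by rwa [hc]⟩
  | dead c h => rw [h] at hs; cases hs
  | _ => cases hs

/-- If the machine halts after `N` steps, then all stacks fit into rows of length `N + 1`, and the
checking automaton sweeps over the first `N` rows of the diagram of that width without finding an
error. -/
theorem checker_accepts_of_accepts {w : List α} (h : T.Accepts w) : T.checker.Accepts w := by
  obtain ⟨N, hN⟩ := h
  let μ := T.diagram w N
  let G : T.checker.Config → Prop := fun c => ∃ n, (T.checker.step w μ)^[n] T.checker.initial = c
  let conf : ℕ → T.Config := fun t => (T.step w)^[t] T.initial
  have hrow : ∀ t ≤ N, RowHolds (row μ t) (conf t).stack N := fun t ht => T.rowHolds_diagram w ht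
  have hstep : ∀ c c', T.checker.step w μ c = c' → G c → G c' := by
    rintro c c' rfl ⟨n, hn⟩
    exact ⟨n + 1, by rw [Function.iterate_succ_apply', hn]⟩
  have h0 := hrow 0 (Nat.zero_le _)
  -- The initial sweep over row `0`, which is blank.
  have hinit : ∀ x ≤ N, G (T.checkConfig (.init (decide (x = 0))) 0 x 0) := by
    intro x
    induction x with
    | zero => exact fun _ => ⟨0, rfl⟩
    | succ x ih =>
      refine fun hx => hstep _ _ ?_ (ih (by omega))
      rw [checker_step_init _ _ _ _ _ _ _ (h0.left x (by omega))
        (fun k => by rw [h0.track x (by omega) k]; simp [conf, initial]),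
        if_neg (by rw [h0.right x (by omega)]; simp; omega)]
      simp
  have hback0 : G (T.checkConfig (.back (conf 0).state) (conf 0).head N 0) := by
    refine hstep _ _ ?_ (hinit N le_rfl)
    rw [checker_step_init _ _ _ _ _ _ _ (h0.left N le_rfl)
      (fun k => by rw [h0.track N le_rfl k]; simp [conf, initial]),
      if_pos (by rw [h0.right N le_rfl]; simp)]
    rfl
  -- The way back from the right to the left end of row `t`.
  have hreturn : ∀ t ≤ N, G (T.checkConfig (.back (conf t).state) (conf t).head N t) →
      ∀ x ≤ N, G (T.checkConfig (.back (conf t).state) (conf t).head (N - x) t) := by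
    intro t ht hG x
    induction x with
    | zero => exact fun _ => hG
    | succ x ih =>
      intro hx
      refine hstep _ _ ?_ (ih (by omega))
      obtain ⟨y, hy⟩ : ∃ y, N - x = y + 1 := ⟨N - x - 1, by omega⟩
      rw [hy, checker_step_back_succ _ _ _ _ _ _ _
        (by simp [(hrow t ht).left (y + 1) (by omega)])]
      congr 1
      omega
  have hnext : ∀ t, conf (t + 1) = T.step w (conf t) := fun t =>
    Function.iterate_succ_apply' _ _ _
  -- The automaton gets to the right end of each row with the right state and head position.
  have hmain : ∀ t ≤ N, G (T.checkConfig (.back (conf t).state) (conf t).head N t) := by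
    intro t
    induction t with
    | zero => exact fun _ => hback0
    | succ t ih =>
      intro ht
      have hr := hrow t (by omega)
      have hr' := hrow (t + 1) ht
      have hcheck : ∀ x ≤ N, ColumnCheck T (conf t).state
          (carry (conf (t + 1)).state (row μ t) (row μ (t + 1)) x) (row μ t x)
          (row μ (t + 1) x) := by
        intro x hx
        refine hr.columnCheck _ ?_ hx
        rw [hnext] at hr'
        exact hr'
      have hup : ∀ x, G (T.checkConfig (.scan (conf t).state
            (carry (conf (t + 1)).state (row μ t) (row μ (t + 1)) x)) (conf t).head x t) →
          G (T.checkConfig (.up (conf t).state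
            (carry (conf (t + 1)).state (row μ t) (row μ (t + 1)) x) (row μ t x))
            (conf t).head x (t + 1)) := fun x =>
        hstep _ _ (T.checker_step_scan w μ _ _ _ _ _)
      have hcarry : ∀ x, T.nextCarried (conf t).state (symbolAt w (conf t).head) (row μ t x)
          (carry (conf (t + 1)).state (row μ t) (row μ (t + 1)) x) = (conf (t + 1)).state := by
        intro x
        rw [hnext]
        exact T.nextCarried_carry w (conf t) hr _ x
      -- The sweep over the rows `t` and `t + 1`, which pass the check in every column.
      have hsweep : ∀ x ≤ N, G (T.checkConfig (.scan (conf t).state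
          (carry (conf (t + 1)).state (row μ t) (row μ (t + 1)) x)) (conf t).head x t) := by
        intro x
        induction x with
        | zero =>
          intro _
          have := hreturn t (by omega) (ih (by omega)) N le_rfl
          rw [Nat.sub_self] at this
          refine hstep _ _ ?_ this
          rw [checker_step_back_zero _ _ _ _ _ _ _ (by simp [hr.left 0])]
          rfl
        | succ x ihx =>
          intro hx
          have h1 := hup x (ihx (by omega))
          refine hstep _ _ (T.checker_step_down w μ _ _ _ _ _) (hstep _ _ ?_ h1)
          rw [T.checker_step_up w μ _ _ _ _ _ _ (hcheck x (by omega)),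
            if_neg (by rw [hr'.right x (by omega)]; simp; omega), hcarry]
      refine hstep _ _ ?_ (hup N (hsweep N le_rfl))
      rw [T.checker_step_up w μ _ _ _ _ _ _ (hcheck N le_rfl),
        if_pos (by rw [hr'.right N le_rfl]; simp), hcarry]
      congr 1
      rw [hnext]
      rfl
  obtain ⟨n, hn⟩ := hmain N le_rfl
  refine ⟨μ, n, ?_⟩
  rw [hn]
  exact ⟨_, hN, rfl⟩

theorem checker_accepts_iff (w : List α) : T.checker.Accepts w ↔ T.Accepts w :=
  ⟨T.accepts_of_checker_accepts, T.checker_accepts_of_accepts⟩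

end StackMachine

/-! ### Programs for stacks as stack machines -/

namespace StackMachine

variable {α : Type u}

/-- The restriction of a machine to a set of states that contains the initial state and is closed
under the transitions. -/
def restrict (T : StackMachine α) (F : Set T.State) (h0 : T.start ∈ F)
    (hF : ∀ q ∈ F, ∀ s τ, T.next q s τ ∈ F) : StackMachine α where
  State := F
  Stack := T.Stack
  finite_stack := T.finite_stack
  Letter := T.Letter
  finite_letter := T.finite_letter
  start := ⟨T.start, h0⟩
  halted := {q | q.1 ∈ T.halted}
  next q s τ := ⟨T.next q.1 s τ, hF q.1 q.2 s τ⟩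
  move q := T.move q.1
  op q := T.op q.1

theorem restrict_accepts_iff (T : StackMachine α) (F : Set T.State) (h0 : T.start ∈ F)
    (hF : ∀ q ∈ F, ∀ s τ, T.next q s τ ∈ F) (w : List α) :
    (T.restrict F h0 hF).Accepts w ↔ T.Accepts w := by
  let f : (T.restrict F h0 hF).Config → T.Config := fun c => ⟨c.state.1, c.head, c.stack⟩
  have hf : Function.Semiconj f ((T.restrict F h0 hF).step w) (T.step w) := fun c => rfl
  refine exists_congr fun n => ?_
  have h := hf.iterate_right n (T.restrict F h0 hF).initial
  change _ = (T.step w)^[n] T.initial at h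
  rw [← h]
  rfl

open Classical in
/-- One step on the input `w`, undefined for halted configurations. -/
noncomputable def step? (T : StackMachine α) (w : List α) (c : T.Config) : Option T.Config :=
  if c.state ∈ T.halted then none else some (T.step w c)

theorem step?_eq_some {T : StackMachine α} {w : List α} {c : T.Config} (h : c.state ∉ T.halted) :
    T.step? w c = some (T.step w c) := if_neg h

theorem accepts_iff_eval_dom (T : StackMachine α) (w : List α) :
    T.Accepts w ↔ (StateTransition.eval (T.step? w) T.initial).Dom := by
  rw [Part.dom_iff_mem]
  simp only [StateTransition.mem_eval]
  constructor
  · rintro ⟨n, hn⟩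
    -- The first halted configuration is reached without passing through a halted one.
    classical
    have hex : ∃ n, ((T.step w)^[n] T.initial).state ∈ T.halted := ⟨n, hn⟩
    refine ⟨_, ?_, if_pos (Nat.find_spec hex)⟩
    have : ∀ m ≤ Nat.find hex, StateTransition.Reaches (T.step? w) T.initial
        ((T.step w)^[m] T.initial) := by
      intro m
      induction m with
      | zero => exact fun _ => .refl
      | succ m ih =>
        intro hm
        refine (ih (by omega)).tail ?_
        rw [Function.iterate_succ_apply']
        exact step?_eq_some (Nat.find_min hex hm)
    exact this _ le_rfl
  · rintro ⟨c, hc, hn⟩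
    have : ∃ n, (T.step w)^[n] T.initial = c := by
      clear hn
      induction hc with
      | refl => exact ⟨0, rfl⟩
      | tail _ h ih =>
        obtain ⟨n, rfl⟩ := ih
        refine ⟨n + 1, ?_⟩
        rw [Function.iterate_succ_apply']
        simp only [step?, Option.mem_def] at h
        split_ifs at h
        exact Option.some.inj h
    obtain ⟨n, rfl⟩ := this
    refine ⟨n, ?_⟩
    by_contra h
    rw [step?_eq_some h] at hn
    cases hn

end StackMachine

section Program

open Turing

variable {α : Type u} {K Γ Λ σ : Type}

/-- The states of a machine that loads the input onto a stack and then runs a stack program: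
* `right`: the head goes to the right end of the input;
* `left`: the head goes to the left, while the letters are being loaded;
* `push l`: the entries of `l` are still to be pushed;
* `call l v`: the statement with label `l` is to be run;
* `run q v`: the statement `q` is to be run. -/
inductive ProgramState (K Γ Λ σ : Type) : Type
  | right
  | left
  | push (l : List Γ)
  | call (l : Λ) (v : σ)
  | run (q : TM2.Stmt (fun _ : K => Γ) Λ σ) (v : σ)

/-- The states of the machine for a program that can occur when the labels are restricted to `S`. -/
def programSupport (M : Λ → TM2.Stmt (fun _ : K => Γ) Λ σ) (block : α → List Γ) (S : Finset Λ) :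
    Set (ProgramState K Γ Λ σ)
  | .right => True
  | .left => True
  | .push l => ∃ a, l <:+ (block a).reverse
  | .call l _ => l ∈ S
  | .run q _ => some q ∈ TM2.stmts M S

theorem programSupport_finite [Finite α] [Finite σ] (M : Λ → TM2.Stmt (fun _ : K => Γ) Λ σ)
    (block : α → List Γ) (S : Finset Λ) :
    (programSupport M block S).Finite := by
  have h1 : (⋃ a, ProgramState.push (K := K) (Γ := Γ) (Λ := Λ) (σ := σ) ''
      {l | l ∈ (block a).reverse.tails}).Finite :=
    Set.finite_iUnion fun a => (List.finite_toSet _).image _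
  have h2 : ((fun e : Λ × σ => ProgramState.call (K := K) (Γ := Γ) e.1 e.2) ''
      ((S : Set Λ) ×ˢ Set.univ)).Finite := (S.finite_toSet.prod Set.finite_univ).image _
  have h3 : ((fun e : Option (TM2.Stmt (fun _ : K => Γ) Λ σ) × σ =>
      e.1.elim ProgramState.left fun q => ProgramState.run q e.2) ''
      ((TM2.stmts M S : Set _) ×ˢ Set.univ)).Finite :=
    ((TM2.stmts M S).finite_toSet.prod Set.finite_univ).image _
  refine ((((Set.finite_singleton ProgramState.right).insert .left).union h1).union
    (h2.union h3)).subset fun s hs => ?_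
  cases s with
  | right => simp
  | left => simp
  | push l =>
    obtain ⟨a, ha⟩ := hs
    exact .inl (.inr (Set.mem_iUnion.2 ⟨a, l, (List.mem_tails l _).2 ha, rfl⟩))
  | call l v => exact .inr (.inl ⟨(l, v), ⟨hs, trivial⟩, rfl⟩)
  | run q v => exact .inr (.inr ⟨(some q, v), ⟨hs, trivial⟩, rfl⟩)

variable [DecidableEq K]

/-- The stacks that are all empty with the exception of `k₀`. -/
def singleStack (k₀ : K) (L : List Γ) : K → List Γ := Function.update (fun _ => []) k₀ L

theorem singleStack_nil (k₀ : K) : singleStack k₀ ([] : List Γ) = fun _ => [] :=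
  Function.update_eq_self k₀ (fun _ => ([] : List Γ))

theorem update_singleStack_cons (k₀ : K) (c : Γ) (L : List Γ) :
    Function.update (singleStack k₀ L) k₀ (c :: singleStack k₀ L k₀) = singleStack k₀ (c :: L) := by
  simp [singleStack]

theorem update_push_eq (S : K → List Γ) (k : K) (c : Γ) :
    (fun i => (if i = k then StackOp.push c else .keep).apply (S i)) =
      Function.update S k (c :: S k) := by
  ext1 i
  by_cases h : i = k
  · subst h; simp [StackOp.apply]
  · simp [h, StackOp.apply]

theorem update_pop_eq (S : K → List Γ) (k : K) :
    (fun i => (if i = k then StackOp.pop else .keep : StackOp Γ).apply (S i)) =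
      Function.update S k (S k).tail := by
  ext1 i
  by_cases h : i = k
  · subst h; simp [StackOp.apply]
  · simp [h, StackOp.apply]

/-- The machine that loads the input word, with each letter `a` replaced by the word `block a`, onto
the stack `k₀`, and then runs the program `M` from the label `l₀` with initial variable `v₀`. A
step of the program is carried out in several steps, one for each elementary statement. -/
def programMachine [Finite K] [Finite Γ] (M : Λ → TM2.Stmt (fun _ : K => Γ) Λ σ) (k₀ : K)
    (block : α → List Γ) (l₀ : Λ) (v₀ : σ) : StackMachine α where
  State := ProgramState K Γ Λ σ
  Stack := K
  finite_stack := inferInstance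
  Letter := Γ
  finite_letter := inferInstance
  start := .right
  halted := {s | ∃ v, s = .run .halt v}
  next
    | .right, .rightMarker, _ => .left
    | .right, _, _ => .right
    | .left, .letter a, _ => .push (block a).reverse
    | .left, _, _ => .call l₀ v₀
    | .push [], _, _ => .left
    | .push (_ :: l), _, _ => .push l
    | .call l v, _, _ => .run (M l) v
    | .run (.push _ _ q) v, _, _ => .run q v
    | .run (.peek k f q) v, _, τ => .run q (f v (τ k))
    | .run (.pop k f q) v, _, τ => .run q (f v (τ k))
    | .run (.load f q) v, _, _ => .run q (f v)
    | .run (.branch f q q') v, _, _ => cond (f v) (.run q v) (.run q' v)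
    | .run (.goto f) v, _, _ => .call (f v) v
    | .run .halt v, _, _ => .run .halt v
  move
    | .right, .rightMarker => -1
    | .right, _ => 1
    | .left, .letter _ => -1
    | _, _ => 0
  op
    | .push (c :: _), k => if k = k₀ then .push c else .keep
    | .run (.push k' f _) v, k => if k = k' then .push (f v) else .keep
    | .run (.pop k' _ _) _, k => if k = k' then .pop else .keep
    | _, _ => .keep

variable [Finite K] [Finite Γ] (M : Λ → TM2.Stmt (fun _ : K => Γ) Λ σ) (k₀ : K)
  (block : α → List Γ) (l₀ : Λ) (v₀ : σ) (w : List α)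

open StateTransition Relation

/-- A configuration of the machine for a program. -/
def programConfig (s : ProgramState K Γ Λ σ) (p : ℕ) (S : K → List Γ) :
    (programMachine M k₀ block l₀ v₀).Config := ⟨s, p, S⟩

/-- The configuration of the stack machine that corresponds to a configuration of the program. -/
def embedCfg : TM2.Cfg (fun _ : K => Γ) Λ σ → (programMachine M k₀ block l₀ v₀).Config
  | ⟨some l, v, S⟩ => programConfig M k₀ block l₀ v₀ (.call l v) 0 S
  | ⟨none, v, S⟩ => programConfig M k₀ block l₀ v₀ (.run .halt v) 0 S

theorem programMachine_reaches_stepAux (q : TM2.Stmt (fun _ : K => Γ) Λ σ) (v : σ)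
    (S : K → List Γ) :
    Reaches ((programMachine M k₀ block l₀ v₀).step? w)
      (programConfig M k₀ block l₀ v₀ (.run q v) 0 S)
      (embedCfg M k₀ block l₀ v₀ (TM2.stepAux q v S)) := by
  induction q generalizing v S with
  | push k f q ih =>
    refine .head ?_ (ih v _)
    refine (StackMachine.step?_eq_some (by rintro ⟨v, h⟩; cases h)).trans (congrArg some ?_)
    exact StackMachine.Config.ext rfl rfl (update_push_eq S k (f v))
  | peek k f q ih =>
    refine .head ?_ (ih _ _)
    exact (StackMachine.step?_eq_some (by rintro ⟨v, h⟩; cases h)).trans (congrArg some rfl)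
  | pop k f q ih =>
    refine .head ?_ (ih _ _)
    refine (StackMachine.step?_eq_some (by rintro ⟨v, h⟩; cases h)).trans (congrArg some ?_)
    exact StackMachine.Config.ext rfl rfl (update_pop_eq S k)
  | load f q ih =>
    refine .head ?_ (ih _ _)
    exact (StackMachine.step?_eq_some (by rintro ⟨v, h⟩; cases h)).trans (congrArg some rfl)
  | branch f q q' ih ih' =>
    simp only [TM2.stepAux]
    cases hf : f v
    · refine .head ?_ (ih' _ _)
      refine (StackMachine.step?_eq_some (by rintro ⟨v, h⟩; cases h)).trans (congrArg some ?_)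
      exact StackMachine.Config.ext
        (by change cond (f v) (ProgramState.run q v) (.run q' v) = _; rw [hf]; rfl) rfl rfl
    · refine .head ?_ (ih _ _)
      refine (StackMachine.step?_eq_some (by rintro ⟨v, h⟩; cases h)).trans (congrArg some ?_)
      exact StackMachine.Config.ext
        (by change cond (f v) (ProgramState.run q v) (.run q' v) = _; rw [hf]; rfl) rfl rfl
  | goto f =>
    refine .single ?_
    exact (StackMachine.step?_eq_some (by rintro ⟨v, h⟩; cases h)).trans (congrArg some rfl)
  | halt => exact .refl

/-- Each step of the program is simulated by at least one step of the machine, because calling a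
statement is a step of its own. -/
theorem programMachine_respects :
    Respects (TM2.step M) ((programMachine M k₀ block l₀ v₀).step? w)
      (fun a b => embedCfg M k₀ block l₀ v₀ a = b) := by
  refine fun_respects.2 fun c => ?_
  obtain ⟨_ | l, v, S⟩ := c
  · exact if_pos ⟨v, rfl⟩
  · refine TransGen.head' ?_ (programMachine_reaches_stepAux M k₀ block l₀ v₀ w (M l) v S)
    exact (StackMachine.step?_eq_some (by rintro ⟨v, h⟩; cases h)).trans (congrArg some rfl)

theorem symbolAt_letter {p : ℕ} (h : p < w.length) : symbolAt w (p + 1) = .letter w[p] := by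
  simp [symbolAt, h]

theorem symbolAt_rightMarker : symbolAt w (w.length + 1) = .rightMarker := by
  simp [symbolAt]

theorem programMachine_reaches_push (l : List Γ) (p : ℕ) (L : List Γ) :
    Reaches ((programMachine M k₀ block l₀ v₀).step? w)
      (programConfig M k₀ block l₀ v₀ (.push l) p (singleStack k₀ L))
      (programConfig M k₀ block l₀ v₀ .left p (singleStack k₀ (l.reverse ++ L))) := by
  induction l generalizing L with
  | nil =>
    refine .single ?_
    exact (StackMachine.step?_eq_some (by rintro ⟨v, h⟩; cases h)).trans (congrArg some rfl)
  | cons c l ih =>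
    have := ih (c :: L)
    rw [List.reverse_cons, List.append_assoc, List.singleton_append]
    refine .head ?_ this
    refine (StackMachine.step?_eq_some (by rintro ⟨v, h⟩; cases h)).trans (congrArg some ?_)
    exact StackMachine.Config.ext rfl rfl ((update_push_eq _ k₀ c).trans
      (update_singleStack_cons k₀ c L))

/-- The head first goes to the right end; the blocks are then pushed from the last letter to the
first, each of them from its end, so that the first letter comes to lie on top. -/
theorem programMachine_reaches_load :
    Reaches ((programMachine M k₀ block l₀ v₀).step? w) (programMachine M k₀ block l₀ v₀).initial
      (embedCfg M k₀ block l₀ v₀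
        ⟨some l₀, v₀, singleStack k₀ (w.flatMap block)⟩) := by
  let T := programMachine M k₀ block l₀ v₀
  have hright : ∀ p ≤ w.length + 1, Reaches (T.step? w) T.initial
      (programConfig M k₀ block l₀ v₀ .right p fun _ => []) := by
    intro p
    induction p with
    | zero => exact fun _ => .refl
    | succ p ih =>
      intro hp
      refine (ih (by omega)).tail ?_
      refine (StackMachine.step?_eq_some (by rintro ⟨v, h⟩; cases h)).trans (congrArg some ?_)
      have hmove : moveHead w.length p 1 = p + 1 := by
        change min (p + 1) (w.length + 1) = _
        omega
      cases p with
      | zero => exact StackMachine.Config.ext rfl hmove rfl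
      | succ p =>
        simp only [StackMachine.step, programConfig]
        rw [symbolAt_letter w (p := p) (by omega)]
        exact StackMachine.Config.ext rfl hmove rfl
  have hturn : Reaches (T.step? w) T.initial
      (programConfig M k₀ block l₀ v₀ .left w.length fun _ => []) := by
    refine (hright _ le_rfl).tail ?_
    refine (StackMachine.step?_eq_some (by rintro ⟨v, h⟩; cases h)).trans (congrArg some ?_)
    simp only [StackMachine.step, programConfig]
    rw [symbolAt_rightMarker]
    rfl
  have hleft : ∀ i ≤ w.length, Reaches (T.step? w) T.initial
      (programConfig M k₀ block l₀ v₀ .left (w.length - i)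
        (singleStack k₀ ((w.drop (w.length - i)).flatMap block))) := by
    intro i
    induction i with
    | zero => exact fun _ => by simpa [singleStack_nil] using hturn
    | succ i ih =>
      intro hi
      refine (ih (by omega)).trans ?_
      obtain ⟨p, hp⟩ : ∃ p, w.length - i = p + 1 := ⟨w.length - i - 1, by omega⟩
      have hp' : w.length - (i + 1) = p := by omega
      have hlt : p < w.length := by omega
      rw [hp, hp', List.drop_eq_getElem_cons hlt, List.flatMap_cons]
      have := programMachine_reaches_push M k₀ block l₀ v₀ w (block w[p]).reverse p
        ((w.drop (p + 1)).flatMap block)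
      rw [List.reverse_reverse] at this
      refine .head ?_ this
      refine (StackMachine.step?_eq_some (by rintro ⟨v, h⟩; cases h)).trans (congrArg some ?_)
      simp only [StackMachine.step, programConfig]
      rw [symbolAt_letter w hlt]
      rfl
  have hend := hleft w.length le_rfl
  rw [Nat.sub_self, List.drop_zero] at hend
  refine hend.tail ?_
  exact (StackMachine.step?_eq_some (by rintro ⟨v, h⟩; cases h)).trans (congrArg some rfl)

theorem programMachine_accepts_iff : (programMachine M k₀ block l₀ v₀).Accepts w ↔
    (StateTransition.eval (TM2.step M)
      ⟨some l₀, v₀, singleStack k₀ (w.flatMap block)⟩).Dom := by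
  rw [StackMachine.accepts_iff_eval_dom,
    reaches_eval (programMachine_reaches_load M k₀ block l₀ v₀ w)]
  exact tr_eval_dom (programMachine_respects M k₀ block l₀ v₀ w) rfl

theorem programSupport_closed [Inhabited Λ] {S : Finset Λ} (hS : TM2.Supports M S) (h0 : l₀ ∈ S)
    {q : ProgramState K Γ Λ σ} (hq : q ∈ programSupport M block S) (s : TapeSymbol α)
    (τ : K → Option Γ) :
    (programMachine M k₀ block l₀ v₀).next q s τ ∈ programSupport M block S := by
  cases q with
  | right => cases s <;> exact trivial
  | left =>
    cases s with
    | letter a => exact ⟨a, List.suffix_refl _⟩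
    | _ => exact h0
  | push l =>
    obtain ⟨a, ha⟩ := hq
    cases l with
    | nil => exact trivial
    | cons c l => exact ⟨a, (List.suffix_cons c l).trans ha⟩
  | call l v =>
    classical
    exact Finset.some_mem_insertNone.2 (Finset.mem_biUnion.2 ⟨l, hq, TM2.stmts₁_self⟩)
  | run q v =>
    have key : ∀ q', q' ∈ TM2.stmts₁ q → some q' ∈ TM2.stmts M S := fun q' h =>
      TM2.stmts_trans h hq
    cases q with
    | branch f q q' =>
      change (cond (f v) (ProgramState.run q v) (.run q' v)) ∈ programSupport M block S
      cases f v
      · exact key q' (by simp [TM2.stmts₁, TM2.stmts₁_self])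
      · exact key q (by simp [TM2.stmts₁, TM2.stmts₁_self])
    | goto f => exact TM2.stmts_supportsStmt hS hq v
    | halt => exact hq
    | _ => exact key _ (by simp [TM2.stmts₁, TM2.stmts₁_self])

/-- A stack program with finitely many labels in use can be run by a machine with finitely many
states. -/
theorem exists_stackMachine_accepts_iff_eval_dom [Finite α] [Finite σ] [Inhabited Λ] {S : Finset Λ}
    (hS : TM2.Supports M S) (h0 : l₀ ∈ S) :
    ∃ T : StackMachine α, Finite T.State ∧ ∀ w : List α, T.Accepts w ↔
      (StateTransition.eval (TM2.step M)
        ⟨some l₀, v₀, singleStack k₀ (w.flatMap block)⟩).Dom :=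
  ⟨(programMachine M k₀ block l₀ v₀).restrict (programSupport M block S) trivial
      fun _ hq s τ => programSupport_closed M k₀ block l₀ v₀ hS h0 hq s τ,
    (programSupport_finite M block S).to_subtype,
    fun w => (StackMachine.restrict_accepts_iff _ _ _ _ w).trans
      (programMachine_accepts_iff M k₀ block l₀ v₀ w)⟩

end Program

/-! ### Recursively enumerable languages are recognized -/

section Code

open Turing ToPartrec Encodable

theorem eval_comp_eq {f g : Code} {v v' : List ℕ} (h : g.eval v = pure v') :
    (f.comp g).eval v = f.eval v' := by
  rw [Code.comp_eval]
  exact (congrArg (Part.bind · f.eval) h).trans (Part.bind_some _ _)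

theorem eval_cons_eq {f g : Code} {v n ns : List ℕ} (hf : f.eval v = pure n)
    (hg : g.eval v = pure ns) : (f.cons g).eval v = pure (n.headI :: ns) := by
  rw [Code.cons_eval]
  exact (congrArg₂ (fun a b : Part (List ℕ) => a.bind fun n => b.bind fun ns =>
    Part.some (n.headI :: ns)) hf hg).trans ((Part.bind_some _ _).trans (Part.bind_some _ _))

theorem eval_tail_comp {f : Code} {v v' : List ℕ} (h : f.eval v = pure v') :
    (Code.tail.comp f).eval v = pure v'.tail := by
  rw [eval_comp_eq h, Code.tail_eval]

theorem eval_head_comp_tail (v : List ℕ) :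
    (Code.head.comp Code.tail).eval v = pure [v.tail.headI] := by
  rw [eval_comp_eq (by rw [Code.tail_eval]), Code.head_eval]

theorem eval_fix_of_zero {f : Code} {v v' : List ℕ} (h : f.eval v = pure (0 :: v')) :
    (Code.fix f).eval v = pure v' := by
  rw [Code.fix_eval]
  refine Part.eq_some_iff.2 (PFun.fix_stop ?_)
  rw [h]
  exact ⟨trivial, rfl⟩

theorem eval_fix_of_one {f : Code} {v v' : List ℕ} (h : f.eval v = pure (1 :: v')) :
    (Code.fix f).eval v = (Code.fix f).eval v' := by
  rw [Code.fix_eval]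
  refine PFun.fix_fwd_eq ?_
  rw [h]
  exact ⟨trivial, rfl⟩

/-- A code that replaces `encode r :: v` by `[encode (l.reverse ++ r)]`, where `v` is the list of
the numbers of the letters of `l`, increased by `1` so that they differ from the default value `0`
that is read at the end of the list. -/
theorem exists_code_reverse (α : Type u) [Primcodable α] :
    ∃ c : Code, ∀ l r : List α,
      c.eval (encode r :: l.map (encode · + 1)) = pure [encode (l.reverse ++ r)] := by
  obtain ⟨cp, hcp⟩ := Code.exists_code (n := 2) (Nat.Partrec'.prim (Nat.Primrec'.of_prim
    (f := fun v : List.Vector ℕ 2 => Nat.succ (Nat.pair v.head v.tail.head))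
    (Primrec.succ.comp (Primrec₂.natPair.comp Primrec.vector_head
      (Primrec.vector_head.comp Primrec.vector_tail)))))
  have hcp' : ∀ a b : ℕ, cp.eval [a, b] = pure [Nat.succ (Nat.pair a b)] := fun a b => by
    refine (hcp ⟨[a, b], rfl⟩).trans ?_
    exact Part.map_some _ _
  let body : Code := (Code.case Code.zero'
    ((Code.succ.comp Code.zero).cons
      ((cp.comp (Code.head.cons ((Code.head.comp Code.tail).cons Code.nil))).cons
        (Code.tail.comp (Code.tail.comp Code.tail))))).comp
    ((Code.head.comp Code.tail).cons Code.id)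
  have hstart : ∀ v : List ℕ, ((Code.head.comp Code.tail).cons Code.id).eval v =
      pure (v.tail.headI :: v) := fun v =>
    eval_cons_eq (n := [v.tail.headI]) (eval_head_comp_tail v) (Code.id_eval v)
  have h0 : ∀ a : ℕ, body.eval [a] = pure [0, a] := fun a => by
    rw [eval_comp_eq (hstart [a]), Code.case_eval]
    exact congrFun Code.zero'_eval [a]
  have h1 : ∀ (a m : ℕ) (v : List ℕ), body.eval (a :: (m + 1) :: v) =
      pure (1 :: Nat.succ (Nat.pair m a) :: v) := fun a m v => by
    rw [eval_comp_eq (hstart _), Code.case_eval]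
    refine eval_cons_eq (n := [1]) ?_ (eval_cons_eq (n := [Nat.succ (Nat.pair m a)]) ?_
      (eval_tail_comp (eval_tail_comp (congrFun Code.tail_eval _))))
    · rw [eval_comp_eq (Code.zero_eval _), Code.succ_eval]
      rfl
    · rw [eval_comp_eq (eval_cons_eq (Code.head_eval _)
        (eval_cons_eq (eval_head_comp_tail _) (Code.nil_eval _)))]
      exact hcp' m a
  -- The body moves one letter from `v` to `r`; the leading `0` or `1` of its result ends the loop
  -- or lets it go on.
  refine ⟨Code.fix body, fun l => ?_⟩
  induction l with
  | nil => exact fun r => eval_fix_of_zero (h0 _)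
  | cons a l ih =>
    intro r
    rw [List.map_cons, eval_fix_of_one (h1 _ _ _), List.reverse_cons, List.append_assoc,
      List.singleton_append, ← ih (a :: r), encode_list_cons]

/-- The input is given as a list of varying length, whereas the codes for partial recursive
functions expect a single number; the number of the reversed word is therefore computed first. -/
theorem exists_code_eval_dom_iff {α : Type u} [Primcodable α] {L : Language α}
    (hL : REPred fun w : List α => w ∈ L) :
    ∃ c : Code, ∀ w : List α, (c.eval (w.map (encode · + 1))).Dom ↔ w ∈ L := by
  have hrev : Partrec fun w : List α => Part.assert (w.reverse ∈ L) fun _ => Part.some () :=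
    Partrec.comp hL Primrec.list_reverse.to_comp
  obtain ⟨cf, hcf⟩ := Code.exists_code (Nat.Partrec'.part_iff₁.2 (Partrec.nat_iff.2 hrev))
  obtain ⟨cr, hcr⟩ := exists_code_reverse α
  refine ⟨cf.comp (cr.comp Code.zero'), fun w => ?_⟩
  have h := hcr w []
  rw [List.append_nil, encode_list_nil] at h
  have h' := hcf ⟨[encode w.reverse], rfl⟩
  have he : (cf.comp (cr.comp Code.zero')).eval (w.map (encode · + 1)) =
      cf.eval [encode w.reverse] :=
    eval_comp_eq ((eval_comp_eq (congrFun Code.zero'_eval _)).trans h)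
  rw [he]
  refine (iff_of_eq (congrArg Part.Dom h')).trans ?_
  simp [List.Vector.head, Part.assert]

/-- The number of a letter, as it is written on the input stack: in binary, with an end symbol. -/
def letterBlock {α : Type u} [Primcodable α] (a : α) : List PartrecToTM2.Γ' :=
  PartrecToTM2.trNat (encode a + 1) ++ [PartrecToTM2.Γ'.cons]

theorem flatMap_letterBlock {α : Type u} [Primcodable α] (w : List α) :
    w.flatMap letterBlock = PartrecToTM2.trList (w.map (encode · + 1)) := by
  induction w with
  | nil => rfl
  | cons a w ih => simp [ih, letterBlock]

instance : Finite PartrecToTM2.K' :=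
  Finite.of_surjective (fun i : Fin 4 => match i with
    | 0 => PartrecToTM2.K'.main
    | 1 => PartrecToTM2.K'.rev
    | 2 => PartrecToTM2.K'.aux
    | 3 => PartrecToTM2.K'.stack) fun k => by
    cases k
    exacts [⟨0, rfl⟩, ⟨1, rfl⟩, ⟨2, rfl⟩, ⟨3, rfl⟩]

theorem exists_stackMachine_accepts_iff {α : Type u} [Finite α] [Primcodable α] {L : Language α}
    (hL : L ∈ RE α) :
    ∃ T : StackMachine α, Finite T.State ∧ ∀ w : List α, T.Accepts w ↔ w ∈ L := by
  obtain ⟨c, hc⟩ := exists_code_eval_dom_iff hL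
  let l₀ := PartrecToTM2.trNormal c PartrecToTM2.Cont'.halt
  let : Inhabited PartrecToTM2.Λ' := ⟨l₀⟩
  have hS := PartrecToTM2.tr_supports c PartrecToTM2.Cont'.halt
  obtain ⟨T, hT, h⟩ := exists_stackMachine_accepts_iff_eval_dom PartrecToTM2.tr
    PartrecToTM2.K'.main (letterBlock (α := α)) l₀ none hS hS.1
  refine ⟨T, hT, fun w => (h w).trans ((iff_of_eq ?_).trans (hc w))⟩
  have he := PartrecToTM2.tr_eval c (w.map (encode · + 1))
  have hi : PartrecToTM2.init c (w.map (encode · + 1)) = ⟨some l₀, none,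
      singleStack PartrecToTM2.K'.main (w.flatMap letterBlock)⟩ := by
    rw [flatMap_letterBlock]
    refine congrArg (TM2.Cfg.mk _ _) ?_
    funext k
    cases k <;> rfl
  rw [← hi]
  exact congrArg Part.Dom he

theorem mem_R_of_mem_RE {α : Type u} [Finite α] [Primcodable α] {L : Language α} (hL : L ∈ RE α) :
    L ∈ R intSquareMemory α := by
  obtain ⟨T, hT, h⟩ := exists_stackMachine_accepts_iff hL
  exact ⟨1, le_rfl, T.checker, fun w => (T.checker_accepts_iff w).trans (h w)⟩

end Code

/-! ### Recognized languages are recursively enumerable -/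

/-- A coding of a finite type. The choice does not matter, since every function on a finite type is
primitive recursive. -/
noncomputable abbrev primcodableOfFinite (β : Type u) [Finite β] : Primcodable β :=
  Primcodable.ofEquiv _ (Finite.equivFin β)

instance {α : Type u} [Finite α] : Finite (TapeSymbol α) :=
  Finite.of_surjective (fun s : Option (Option α) => match s with
    | none => TapeSymbol.leftMarker
    | some none => TapeSymbol.rightMarker
    | some (some a) => TapeSymbol.letter a) fun s => by
    cases s with
    | leftMarker => exact ⟨none, rfl⟩
    | letter a => exact ⟨some (some a), rfl⟩
    | rightMarker => exact ⟨some none, rfl⟩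

theorem primrec_symbolAt {α : Type u} [Finite α] [Primcodable α] [Primcodable (TapeSymbol α)] :
    Primrec₂ (symbolAt : List α → ℕ → TapeSymbol α) := by
  have h : Primrec₂ fun (e : List α × ℕ) (p : ℕ) =>
      (Option.casesOn (e.1[p]?) TapeSymbol.rightMarker TapeSymbol.letter : TapeSymbol α) :=
    Primrec.option_casesOn (Primrec.list_getElem?.comp (Primrec.fst.comp Primrec.fst) Primrec.snd)
      (Primrec.const _) ((Primrec.dom_finite TapeSymbol.letter).comp Primrec.snd).to₂
  refine (Primrec.nat_casesOn Primrec.snd (Primrec.const TapeSymbol.leftMarker) h).of_eq ?_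
  rintro ⟨w, _ | p⟩
  · rfl
  · simp only [symbolAt]
    cases w[p]? <;> rfl

theorem primrec_moveHead [Primcodable SignType] :
    Primrec fun e : ℕ × ℕ × SignType => moveHead e.1 e.2.1 e.2.2 := by
  have hs : Primrec fun e : ℕ × ℕ × SignType => e.2.2 := Primrec.snd.comp Primrec.snd
  have hp : Primrec fun e : ℕ × ℕ × SignType => e.2.1 := Primrec.fst.comp Primrec.snd
  refine (Primrec.ite (Primrec.eq.comp hs (Primrec.const SignType.neg)) (Primrec.pred.comp hp)
    (Primrec.ite (Primrec.eq.comp hs (Primrec.const SignType.zero)) hp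
      (Primrec.nat_min.comp (Primrec.succ.comp hp) (Primrec.succ.comp Primrec.fst)))).of_eq ?_
  rintro ⟨n, p, _ | _ | _⟩ <;> simp [moveHead]

/-- Codes for cells of the plane: each coordinate is given as a difference of natural numbers. -/
abbrev CellCode : Type := (ℕ × ℕ) × (ℕ × ℕ)

/-- The cell with a given code. -/
def CellCode.toCell (e : CellCode) : intSquareMemory.Cell :=
  ((e.1.1 : ℤ) - e.1.2, (e.2.1 : ℤ) - e.2.2)

/-- A number that determines the cell. -/
def cellIndex (z : ℤ × ℤ) : ℕ :=
  Encodable.encode ((z.1.toNat, (-z.1).toNat), (z.2.toNat, (-z.2).toNat))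

theorem cellIndex_injective : Function.Injective cellIndex := by
  rintro ⟨a, b⟩ ⟨a', b'⟩ h
  have h' := Encodable.encode_injective h
  simp only [Prod.mk.injEq] at h' ⊢
  omega

/-- The index of the cell with a given code. -/
def CellCode.index (e : CellCode) : ℕ :=
  Encodable.encode ((e.1.1 - e.1.2, e.1.2 - e.1.1), (e.2.1 - e.2.2, e.2.2 - e.2.1))

theorem CellCode.index_eq (e : CellCode) : e.index = cellIndex e.toCell := by
  obtain ⟨⟨a, b⟩, c, d⟩ := e
  simp only [index, cellIndex, toCell]
  congr <;> omega

theorem primrec_cellCodeIndex : Primrec CellCode.index := by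
  have h1 : Primrec fun e : CellCode => e.1.1 := Primrec.fst.comp Primrec.fst
  have h2 : Primrec fun e : CellCode => e.1.2 := Primrec.snd.comp Primrec.fst
  have h3 : Primrec fun e : CellCode => e.2.1 := Primrec.fst.comp Primrec.snd
  have h4 : Primrec fun e : CellCode => e.2.2 := Primrec.snd.comp Primrec.snd
  exact Primrec.encode.comp (((Primrec.nat_sub.comp h1 h2).pair (Primrec.nat_sub.comp h2 h1)).pair
    ((Primrec.nat_sub.comp h3 h4).pair (Primrec.nat_sub.comp h4 h3)))

/-- The displacement caused by a memory command. -/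
def displacement : Option intSquareMemory.Mark → ℤ × ℤ
  | none => 0
  | some m => m.1

/-- The code of a cell after a command. -/
def CellCode.exec (m : Option intSquareMemory.Mark) (e : CellCode) : CellCode :=
  ((e.1.1 + (displacement m).1.toNat, e.1.2 + (-(displacement m).1).toNat),
    (e.2.1 + (displacement m).2.toNat, e.2.2 + (-(displacement m).2).toNat))

theorem CellCode.toCell_exec (m : Option intSquareMemory.Mark) (e : CellCode) :
    (e.exec m).toCell = intSquareMemory.exec e.toCell m := by
  have h : @Eq (ℤ × ℤ) (intSquareMemory.exec e.toCell m)
      (@HAdd.hAdd (ℤ × ℤ) (ℤ × ℤ) (ℤ × ℤ) _ e.toCell (displacement m)) := by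
    cases m with
    | none => exact (add_zero (M := ℤ × ℤ) _).symm
    | some m => exact cayleyMemory_exec_some (A := ℤ × ℤ) _ _
  rw [h]
  refine Prod.ext ?_ ?_ <;> simp [toCell, exec] <;> omega

theorem primrec_cellCodeExec [Primcodable intSquareMemory.Mark] : Primrec₂ CellCode.exec := by
  have := intSquareMemory.finite_mark
  have hd : ∀ f : ℤ × ℤ → ℕ, Primrec fun e : Option intSquareMemory.Mark × CellCode =>
      f (displacement e.1) := fun f =>
    (Primrec.dom_finite fun m : Option intSquareMemory.Mark => f (displacement m)).comp Primrec.fst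
  have h : Primrec fun e : Option intSquareMemory.Mark × CellCode => e.2 := Primrec.snd
  have h1 := Primrec.fst.comp (Primrec.fst.comp h)
  have h2 := Primrec.snd.comp (Primrec.fst.comp h)
  have h3 := Primrec.fst.comp (Primrec.snd.comp h)
  have h4 := Primrec.snd.comp (Primrec.snd.comp h)
  exact ((Primrec.nat_add.comp h1 (hd fun z => z.1.toNat)).pair
      (Primrec.nat_add.comp h2 (hd fun z => (-z.1).toNat))).pair
    ((Primrec.nat_add.comp h3 (hd fun z => z.2.toNat)).pair
      (Primrec.nat_add.comp h4 (hd fun z => (-z.2).toNat)))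

namespace Automaton

variable {h : ℕ} {α : Type u} (A : Automaton h α intSquareMemory)

/-- Codes for configurations. -/
abbrev ConfigCode : Type := A.State × (Fin h → ℕ) × CellCode

/-- The configuration with a given code. -/
def ConfigCode.toConfig {A : Automaton h α intSquareMemory} (c : A.ConfigCode) : A.Config :=
  ⟨c.1, c.2.1, c.2.2.toCell⟩

/-- The memory content given by a list of symbols, in the order of the indices of the cells; the
cells beyond the end of the list contain `s₀`. -/
def contentOfList {β : Type} (s₀ : β) (l : List β) (z : intSquareMemory.Cell) : β :=
  l.getD (cellIndex z) s₀

/-- One step on codes for configurations. -/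
def stepCode (s₀ : A.Sym) (e : List α × List A.Sym) (c : A.ConfigCode) : A.ConfigCode :=
  let r := A.trans c.1 (fun i => symbolAt e.1 (c.2.1 i)) (e.2.getD c.2.2.index s₀)
  (r.1, fun i => moveHead e.1.length (c.2.1 i) (r.2.1 i), c.2.2.exec r.2.2)

theorem toConfig_stepCode (s₀ : A.Sym) (w : List α) (l : List A.Sym) (c : A.ConfigCode) :
    (A.stepCode s₀ (w, l) c).toConfig = A.step w (contentOfList s₀ l) c.toConfig := by
  simp only [stepCode, ConfigCode.toConfig, step, contentOfList, CellCode.index_eq,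
    CellCode.toCell_exec]

theorem primrec_stepCode [Finite α] [Primcodable α] [Primcodable A.State] [Primcodable A.Sym]
    (s₀ : A.Sym) : Primrec₂ (A.stepCode s₀) := by
  have := A.finite_state
  have := A.finite_sym
  let _ := primcodableOfFinite (TapeSymbol α)
  let _ := primcodableOfFinite SignType
  have := intSquareMemory.finite_mark
  let _ := primcodableOfFinite intSquareMemory.Mark
  let X := (List α × List A.Sym) × A.ConfigCode
  have hw : Primrec fun x : X => x.1.1 := Primrec.fst.comp Primrec.fst
  have hl : Primrec fun x : X => x.1.2 := Primrec.snd.comp Primrec.fst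
  have hq : Primrec fun x : X => x.2.1 := Primrec.fst.comp Primrec.snd
  have hp : Primrec fun x : X => x.2.2.1 := Primrec.fst.comp (Primrec.snd.comp Primrec.snd)
  have hz : Primrec fun x : X => x.2.2.2 := Primrec.snd.comp (Primrec.snd.comp Primrec.snd)
  have hhead : Primrec₂ fun (x : X) (i : Fin h) => x.2.2.1 i :=
    Primrec.fin_app.comp (hp.comp Primrec.fst) Primrec.snd
  have hsym : Primrec fun (x : X) (i : Fin h) => symbolAt x.1.1 (x.2.2.1 i) :=
    Primrec.fin_curry.2 (primrec_symbolAt.comp (hw.comp Primrec.fst) hhead)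
  have hmem : Primrec fun x : X => x.1.2.getD x.2.2.2.index s₀ :=
    (Primrec.list_getD s₀).comp hl (primrec_cellCodeIndex.comp hz)
  have htrans : Primrec fun x : X =>
      A.trans x.2.1 (fun i => symbolAt x.1.1 (x.2.2.1 i)) (x.1.2.getD x.2.2.2.index s₀) :=
    (Primrec.dom_finite fun y : A.State × (Fin h → TapeSymbol α) × A.Sym =>
      A.trans y.1 y.2.1 y.2.2).comp (hq.pair (hsym.pair hmem))
  have hmove : Primrec fun x : X => (A.trans x.2.1 (fun i => symbolAt x.1.1 (x.2.2.1 i))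
      (x.1.2.getD x.2.2.2.index s₀)).2.1 := Primrec.fst.comp (Primrec.snd.comp htrans)
  refine (Primrec.fst.comp htrans).pair (Primrec.pair ?_
    (primrec_cellCodeExec.comp (Primrec.snd.comp (Primrec.snd.comp htrans)) hz))
  exact Primrec.fin_curry.2 (primrec_moveHead.comp
    ((Primrec.list_length.comp (hw.comp Primrec.fst)).pair
      (Primrec.pair hhead (Primrec.fin_app.comp (hmove.comp Primrec.fst) Primrec.snd))))

/-- Within a given number of steps only finitely many cells are visited, so that the rest of the
memory content does not matter. -/
theorem accepts_iff_exists_list (s₀ : A.Sym) (w : List α) : A.Accepts w ↔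
    ∃ (t : ℕ) (l : List A.Sym),
      ((A.stepCode s₀ (w, l))^[t] (A.start, fun _ => 0, (0, 0), (0, 0))).1 ∈ A.accepting := by
  have hcode : ∀ (l : List A.Sym) (t : ℕ),
      ConfigCode.toConfig ((A.stepCode s₀ (w, l))^[t] (A.start, fun _ => 0, (0, 0), (0, 0))) =
        (A.step w (contentOfList s₀ l))^[t] A.initial := by
    intro l t
    have hs : Function.Semiconj (ConfigCode.toConfig (A := A)) (A.stepCode s₀ (w, l))
        (A.step w (contentOfList s₀ l)) := A.toConfig_stepCode s₀ w l
    exact hs.iterate_right t _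
  constructor
  · rintro ⟨μ, t, ht⟩
    obtain ⟨B, hB⟩ := ((Set.finite_Iic t).image
      fun i => cellIndex ((A.step w μ)^[i] A.initial).cell).bddAbove
    let l := (List.range (B + 1)).map fun n => μ (Function.invFun (α := ℤ × ℤ) cellIndex n)
    have hl : ∀ z, cellIndex z ≤ B → contentOfList s₀ l z = μ z := by
      intro z hz
      simp only [contentOfList, l]
      rw [List.getD_eq_getElem _ _ (by simpa using Nat.lt_succ_of_le hz)]
      simp [Function.leftInverse_invFun cellIndex_injective z]
    have hrun : ∀ i ≤ t, (A.step w (contentOfList s₀ l))^[i] A.initial =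
        (A.step w μ)^[i] A.initial := by
      intro i
      induction i with
      | zero => exact fun _ => rfl
      | succ i ih =>
        intro hi
        rw [Function.iterate_succ_apply', Function.iterate_succ_apply', ih (by omega)]
        simp only [step]
        rw [hl _ (hB ⟨i, Set.mem_Iic.2 (by omega), rfl⟩)]
    refine ⟨t, l, ?_⟩
    rw [← hrun t le_rfl, ← hcode] at ht
    exact ht
  · rintro ⟨t, l, ht⟩
    refine ⟨contentOfList s₀ l, t, ?_⟩
    rw [← hcode]
    exact ht

theorem rePred_accepts [Finite α] [Primcodable α] : REPred fun w : List α => A.Accepts w := by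
  have := A.finite_state
  have := A.finite_sym
  let _ := primcodableOfFinite A.State
  let _ := primcodableOfFinite A.Sym
  rcases isEmpty_or_nonempty A.Sym with hs | ⟨⟨s₀⟩⟩
  · -- Without memory symbols there is no memory content at all.
    refine (Partrec.none (α := List α) (σ := ℕ)).dom_re.of_eq fun w => ?_
    refine iff_of_false (fun h => h) ?_
    rintro ⟨μ, -⟩
    exact hs.false (μ (0, 0))
  · classical
    let run : List α → ℕ × List A.Sym → Bool := fun w x =>
      decide (((A.stepCode s₀ (w, x.2))^[x.1] (A.start, fun _ => 0, (0, 0), (0, 0))).1 ∈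
        A.accepting)
    have hrun : Primrec₂ run := by
      have hstep : Primrec₂ fun (y : List α × ℕ × List A.Sym) (c : A.ConfigCode) =>
          A.stepCode s₀ (y.1, y.2.2) c :=
        (A.primrec_stepCode s₀).comp ((Primrec.fst.comp Primrec.fst).pair
          (Primrec.snd.comp (Primrec.snd.comp Primrec.fst))) Primrec.snd
      have hiter := Primrec.nat_iterate (Primrec.fst.comp Primrec.snd)
        (Primrec.const ((A.start, fun _ => 0, (0, 0), (0, 0)) : A.ConfigCode)) hstep
      exact (Primrec.dom_finite fun q : A.State => decide (q ∈ A.accepting)).comp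
        (Primrec.fst.comp hiter)
    let test : List α → ℕ → Bool := fun w n =>
      Option.casesOn (Encodable.decode (α := ℕ × List A.Sym) n) false (run w)
    have htest : Primrec₂ test :=
      Primrec.option_casesOn (Primrec.decode.comp Primrec.snd) (Primrec.const false)
        (hrun.comp (Primrec.fst.comp Primrec.fst) Primrec.snd)
    have hsearch : Partrec fun w : List α => Nat.rfind fun n => Part.some (test w n) :=
      Partrec.rfind htest.to_comp.partrec₂
    refine hsearch.dom_re.of_eq fun w => ?_
    refine Nat.rfind_dom.trans ?_
    rw [A.accepts_iff_exists_list s₀]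
    constructor
    · rintro ⟨n, hn, -⟩
      have hn : test w n = true := (Part.mem_some_iff.1 hn).symm
      simp only [test] at hn
      cases hd : Encodable.decode (α := ℕ × List A.Sym) n with
      | none => simp [hd] at hn
      | some x =>
        rw [hd] at hn
        exact ⟨x.1, x.2, of_decide_eq_true hn⟩
    · rintro ⟨t, l, hl⟩
      refine ⟨Encodable.encode (t, l), Part.mem_some_iff.2 ?_, fun _ => trivial⟩
      simp only [test, Encodable.encodek]
      exact (decide_eq_true hl).symm

end Automaton

theorem mem_RE_of_mem_R {α : Type u} [Finite α] [Primcodable α] {L : Language α}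
    (hL : L ∈ R intSquareMemory α) : L ∈ RE α := by
  obtain ⟨h, -, A, hA⟩ := hL
  exact A.rePred_accepts.of_eq hA

end AuxMemory

theorem mainTheorem8 {α : Type*} [Finite α] [Primcodable α] :
    AuxMemory.R AuxMemory.intSquareMemory α = AuxMemory.RE α :=
  Set.Subset.antisymm (fun _ => AuxMemory.mem_RE_of_mem_R) fun _ => AuxMemory.mem_R_of_mem_RE
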